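/- Throughout, a \emph{graph} is a connected, locally finite simplicial graph without loops or multiple edges; its vertex set carries the graph distance $d$ in which adjacent vertices are at distance $1$. For a vertex $x$ of a graph $X$ and $R>0$, the ball $B_X(x,R)$ consists of the vertices at distance at most $R$ from $x$, with its intrinsic metric (lengths of shortest paths of $X$ that stay in the ball); an isometry between two balls is a bijection preserving these intrinsic metrics. A graph $Y$ is \emph{$R$-locally $X$} if for every vertex $y$ of $Y$ there is a vertex $x$ of $X$ such that $B_X(x,R)$ and $B_Y(y,R)$ are isometric. A \emph{covering} $X\to Y$ is a surjective map between the vertex sets that sends, for every vertex $x$, the neighbours of $x$ bijectively onto the neighbours of the image of $x$. For $0<r\le R$, the graph $X$ is \emph{SLG-rigid at scales $(r,R)$} if for every graph $Y$ that is $R$-locally $X$, all vertices $x\in X$ and $y\in Y$, and every isometry $f$ from $B_X(x,R)$ onto $B_Y(y,R)$, the restriction of $f$ to $B_X(x,r)$ extends to a covering from $X$ to $Y$. The graph $X$ is \emph{SLG-rigid} if for all large enough $r$ there is $R\ge r$ such that $X$ is SLG-rigid at scales $(r,R)$. A map $f$ from the vertex set of a graph $X$ to that of a connected graph $T$ is a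 \emph{quasi-isometry} if there are $C\ge 1$ and $K\ge 0$ such that every vertex of $T$ is at distance at most $K$ from the image of $f$ and $C^{-1}d(x,x')-K\le d(f(x),f(x'))\le C\,d(x,x')+K$ for all vertices $x,x'$ of $X$. A \emph{quasi-tree} is a graph that admits a quasi-isometry to a (not necessarily locally finite) simplicial tree. \textbf{Theorem.} Let $X$ be a quasi-tree whose group of isometries acts cocompactly, that is, with finitely many orbits of vertices. Then $X$ is SLG-rigid. In particular, let $\Gamma$ be a finitely generated virtually free group (a finitely generated group with a free subgroup of finite index) and let $S$ be any finite symmetric generating set of $\Gamma$. Then the Cayley graph $(\Gamma,S)$, whose vertex set is $\Gamma$ with the distance $d(g,h)=|g^{-1}h|_S$, is SLG-rigid. -/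

import Mathlib

universe u v w

namespace LocalGlobal

/-- Local finiteness: every vertex has finitely many neighbours. -/
def IsLocallyFinite {V : Type u} (X : SimpleGraph V) : Prop :=
  ∀ x : V, (X.neighborSet x).Finite

/-- The standing convention: a graph is connected (hence nonempty) and locally finite;
loops and multiple edges are excluded by `SimpleGraph`. -/
structure IsGraph {V : Type u} (X : SimpleGraph V) : Prop where
  connected : X.Connected
  locallyFinite : IsLocallyFinite X

/-- `f` is a `(C, K)`-quasi-isometry between the vertex sets of `X` and `Y`, equipped with the
graph distances. -/
structure IsQuasiIsometry {V : Type u} {W : Type v} (X : SimpleGraph V) (Y : SimpleGraph W)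
    (C K : ℝ) (f : V → W) : Prop where
  one_le : 1 ≤ C
  nonneg : 0 ≤ K
  coarselySurjective : ∀ y : W, ∃ x : V, (Y.dist y (f x) : ℝ) ≤ K
  lower : ∀ x x' : V, C⁻¹ * (X.dist x x' : ℝ) - K ≤ (Y.dist (f x) (f x') : ℝ)
  upper : ∀ x x' : V, (Y.dist (f x) (f x') : ℝ) ≤ C * (X.dist x x' : ℝ) + K

/-- A quasi-tree is a graph that is quasi-isometric to a tree. The tree need not be locally
finite. -/
def IsQuasiTree {V : Type u} (X : SimpleGraph V) : Prop :=
  IsGraph X ∧ ∃ (W : Type w) (T : SimpleGraph W), T.IsTree ∧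
    ∃ (C K : ℝ) (f : V → W), IsQuasiIsometry X T C K f

/-- The isometry group of the vertex set, that is, the automorphism group of the graph, acts
cocompactly: finitely many vertices meet all its orbits. -/
def HasCocompactIsometryGroup {V : Type u} (X : SimpleGraph V) : Prop :=
  ∃ F : Finset V, ∀ x : V, ∃ a ∈ F, ∃ g : X ≃g X, g a = x

/-- The vertices of the ball `B(x, R)`. -/
def ball {V : Type u} (X : SimpleGraph V) (x : V) (R : ℝ) : Set V :=
  {z | (X.dist x z : ℝ) ≤ R}

/-- The intrinsic metric of the ball `B(x, R)`: lengths of shortest paths that stay inside the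
ball. -/
noncomputable def ballDist {V : Type u} (X : SimpleGraph V) (x : V) (R : ℝ)
    (a b : ball X x R) : ℕ :=
  (X.induce (ball X x R)).dist a b

/-- Isometries from `B(x, R)` onto `B(y, R)` for the intrinsic metrics of the two balls. The
centre `x` is not required to be sent to the centre `y`. -/
structure BallIsometry {V : Type u} {W : Type v} (X : SimpleGraph V) (Y : SimpleGraph W)
    (x : V) (y : W) (R : ℝ) where
  toEquiv : ball X x R ≃ ball Y y R
  isometry : ∀ a b : ball X x R,
    ballDist Y y R (toEquiv a) (toEquiv b) = ballDist X x R a b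

/-- `Y` is `R`-locally `X`. -/
def IsLocally {V : Type u} {W : Type v} (R : ℝ) (Y : SimpleGraph W) (X : SimpleGraph V) : Prop :=
  ∀ y : W, ∃ x : V, Nonempty (BallIsometry X Y x y R)

/-- `p` is a covering of graphs: a surjective map that sends the neighbours of each vertex `x`
bijectively onto the neighbours of `p x`. -/
structure IsCovering {V : Type u} {W : Type v} (X : SimpleGraph V) (Y : SimpleGraph W)
    (p : V → W) : Prop where
  surjective : Function.Surjective p
  bijOn : ∀ x : V, Set.BijOn p (X.neighborSet x) (Y.neighborSet (p x))

/-- `X` is strongly local to global rigid at scales `(r, R)`. -/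
def IsSLGRigidAt {V : Type u} (X : SimpleGraph V) (r R : ℝ) : Prop :=
  ∀ (W : Type v) (Y : SimpleGraph W), IsGraph Y → IsLocally R Y X →
    ∀ (x : V) (y : W) (f : BallIsometry X Y x y R),
      ∃ p : V → W, IsCovering X Y p ∧
        ∀ z : ball X x R, z.1 ∈ ball X x r → p z.1 = (f.toEquiv z).1

/-- `X` is SLG-rigid: for all large enough `r` there is `R ≥ r` such that `X` is SLG-rigid at
scales `(r, R)`. -/
def IsSLGRigid {V : Type u} (X : SimpleGraph V) : Prop :=
  ∃ r₀ : ℝ, ∀ r : ℝ, r₀ ≤ r → 0 < r → ∃ R : ℝ, r ≤ R ∧ IsSLGRigidAt.{u, v} X r R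

/-- A group is virtually free if it has a free subgroup of finite index. -/
def IsVirtuallyFree (Γ : Type u) [Group Γ] : Prop :=
  ∃ H : Subgroup Γ, H.FiniteIndex ∧ IsFreeGroup H

end LocalGlobal

/-! A chart is an isomorphism from a ball of `X` onto a concentric ball of `Y`. By compactness and
cocompactness, a transition map between two charts of large radius agrees on a smaller ball with an
automorphism of `X` (`exists_radius_forall_exists_iso`). Correcting the second chart by this
automorphism moves a chart to a nearby centre without any loss of radius (`exists_chart_move`), so
the process can be iterated forever. In general, transport around a loop could give a different
chart. Here the charts are indexed by the vertices of the tree `T`, which has no loops, so they can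
be chosen outwards from the root. At a vertex `z`, the charts at all nearby tree vertices agree, and
evaluating the chart indexed by `q z` at `z` gives the covering (`exists_covering_extension`).

Isometries between balls need not preserve centres. In a cocompact quasi-tree they do so up to a
bounded error (`exists_dist_le_of_ball_subset`), and a slightly larger radius absorbs it.

For a virtually free group, the tree is that of reduced words in a basis of the free subgroup
(`exists_isCoarse_wordTree`). -/

namespace LocalGlobal

/-! ### Isomorphisms between balls -/

section Charts

variable {V V' V'' : Type*} {X : SimpleGraph V} {Y : SimpleGraph V'} {Z : SimpleGraph V''}

/-- `φ` restricts to a graph isomorphism from the ball `B(x, n)` of `X` onto the ball `B(y, n)`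
of `Y`. -/
structure IsBallIso (X : SimpleGraph V) (Y : SimpleGraph V') (x : V) (y : V') (n : ℕ)
    (φ : V → V') : Prop where
  injOn : ∀ a b, X.dist x a ≤ n → X.dist x b ≤ n → φ a = φ b → a = b
  mapsTo : ∀ a, X.dist x a ≤ n → Y.dist y (φ a) ≤ n
  surjOn : ∀ b, Y.dist y b ≤ n → ∃ a, X.dist x a ≤ n ∧ φ a = b
  adj_iff : ∀ a b, X.dist x a ≤ n → X.dist x b ≤ n → (Y.Adj (φ a) (φ b) ↔ X.Adj a b)

/-- `φ` restricts to an isomorphism of balls of radius `n` that maps the centre `x` to the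
centre. -/
abbrev IsChart (X : SimpleGraph V) (Y : SimpleGraph V') (n : ℕ) (x : V) (φ : V → V') : Prop :=
  IsBallIso X Y x (φ x) n φ

theorem exists_adj_dist_eq (hX : X.Connected) {a b : V} {n : ℕ} (h : X.dist a b = n + 1) :
    ∃ c, X.dist a c = n ∧ X.Adj c b := by
  obtain ⟨p, hp⟩ := hX.exists_walk_length_eq_dist b a
  rw [SimpleGraph.dist_comm, h] at hp
  cases p with
  | nil => simp at hp
  | @cons _ c _ hbc p =>
    refine ⟨c, ?_, hbc.symm⟩
    rw [SimpleGraph.Walk.length_cons] at hp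
    have h1 : X.dist c a ≤ p.length := SimpleGraph.dist_le p
    have h2 : X.dist a b ≤ X.dist a c + X.dist c b := hX.dist_triangle
    have h3 : X.dist c b = 1 := SimpleGraph.dist_eq_one_iff_adj.2 hbc.symm
    rw [SimpleGraph.dist_comm] at h1
    omega

theorem dist_adj_le (hX : X.Connected) (a : V) {b c : V} (h : X.Adj b c) :
    X.dist a c ≤ X.dist a b + 1 := by
  rw [← SimpleGraph.dist_eq_one_iff_adj.2 h]
  exact hX.dist_triangle

/-- A function of the vertices that changes by at most `k` along every edge is `k`-Lipschitz. -/
theorem dist_le_mul_of_adj (hX : X.Connected) (hY : Y.Connected) {f : V → V'} {k : ℕ}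
    (h : ∀ a b, X.Adj a b → Y.dist (f a) (f b) ≤ k) (a b : V) :
    Y.dist (f a) (f b) ≤ k * X.dist a b := by
  induction hn : X.dist a b generalizing b with
  | zero =>
    obtain rfl := hX.dist_eq_zero_iff.1 hn
    simp
  | succ n ih =>
    obtain ⟨c, hc, hcb⟩ := exists_adj_dist_eq hX hn
    have h1 : Y.dist (f a) (f b) ≤ Y.dist (f a) (f c) + Y.dist (f c) (f b) := hY.dist_triangle
    have h2 := ih c hc
    have h3 := h c b hcb
    rw [mul_add, mul_one]
    omega

namespace IsBallIso

variable {x : V} {y : V'} {z : V''} {n m : ℕ} {φ : V → V'} {ψ : V' → V''}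

/-- The hypothesis keeps a geodesic from `a` to `b` inside the ball, where `φ` preserves edges. -/
theorem dist_le (hX : X.Connected) (hY : Y.Connected) (h : IsBallIso X Y x y n φ) {a b : V}
    (hab : X.dist x a + X.dist a b ≤ n) : Y.dist (φ a) (φ b) ≤ X.dist a b := by
  induction hk : X.dist a b generalizing b with
  | zero =>
    obtain rfl := hX.dist_eq_zero_iff.1 hk
    simp
  | succ k ih =>
    obtain ⟨c, hc, hcb⟩ := exists_adj_dist_eq hX hk
    have h1 : X.dist x c ≤ X.dist x a + X.dist a c := hX.dist_triangle
    have h2 : X.dist x b ≤ X.dist x a + X.dist a b := hX.dist_triangle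
    have h3 := ih (b := c) (by omega) hc
    have h4 := dist_adj_le hY (φ a) ((h.adj_iff c b (by omega) (by omega)).2 hcb)
    omega

theorem exists_inverse (h : IsBallIso X Y x y n φ) :
    ∃ ψ : V' → V, IsBallIso Y X y x n ψ ∧ (∀ a, X.dist x a ≤ n → ψ (φ a) = a) ∧
      ∀ b, Y.dist y b ≤ n → φ (ψ b) = b := by
  classical
  have hs : ∀ b, ∃ a, Y.dist y b ≤ n → X.dist x a ≤ n ∧ φ a = b := fun b => by
    by_cases hb : Y.dist y b ≤ n
    · obtain ⟨a, ha⟩ := h.surjOn b hb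
      exact ⟨a, fun _ => ha⟩
    · exact ⟨x, fun h => absurd h hb⟩
  choose ψ hψ using hs
  have hl : ∀ a, X.dist x a ≤ n → ψ (φ a) = a := fun a ha =>
    h.injOn _ _ (hψ _ (h.mapsTo a ha)).1 ha (hψ _ (h.mapsTo a ha)).2
  refine ⟨ψ, ⟨?_, fun b hb => (hψ b hb).1, fun a ha => ⟨φ a, h.mapsTo a ha, hl a ha⟩, ?_⟩, hl,
    fun b hb => (hψ b hb).2⟩
  · intro a b ha hb hab
    rw [← (hψ a ha).2, hab, (hψ b hb).2]
  · intro a b ha hb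
    rw [← h.adj_iff _ _ (hψ a ha).1 (hψ b hb).1, (hψ a ha).2, (hψ b hb).2]

/-- Both `φ` and its inverse are nonexpanding along geodesics that stay in the large balls. The
hypothesis `hy` is what keeps those issuing from `φ x'` inside, as `φ` need not respect the centres.
-/
theorem restrict (hX : X.Connected) (hY : Y.Connected) (h : IsBallIso X Y x y n φ) {x' : V}
    (hx : X.dist x x' + m ≤ n) (hy : Y.dist y (φ x') + m ≤ n) : IsChart X Y m x' φ := by
  have hb : ∀ a, X.dist x' a ≤ m → X.dist x a ≤ n := fun a ha => by
    have : X.dist x a ≤ X.dist x x' + X.dist x' a := hX.dist_triangle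
    omega
  refine ⟨fun a b ha hb' => h.injOn a b (hb a ha) (hb b hb'), fun a ha => ?_, fun b hb' => ?_,
    fun a b ha hb' => h.adj_iff a b (hb a ha) (hb b hb')⟩
  · exact (h.dist_le hX hY (by omega)).trans ha
  · obtain ⟨ψ, hψ, hl, hr⟩ := h.exists_inverse
    have h1 : Y.dist y b ≤ Y.dist y (φ x') + Y.dist (φ x') b := hY.dist_triangle
    have h2 := hψ.dist_le hY hX (a := φ x') (b := b) (by omega)
    rw [hl x' (by omega)] at h2
    exact ⟨ψ b, by omega, hr b (by omega)⟩

theorem comp (h : IsBallIso X Y x y n φ) (h' : IsBallIso Y Z y z n ψ) :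
    IsBallIso X Z x z n (ψ ∘ φ) := by
  refine ⟨fun a b ha hb hab => h.injOn a b ha hb (h'.injOn _ _ (h.mapsTo a ha) (h.mapsTo b hb) hab),
    fun a ha => h'.mapsTo _ (h.mapsTo a ha), fun c hc => ?_, fun a b ha hb => ?_⟩
  · obtain ⟨b, hb, rfl⟩ := h'.surjOn c hc
    obtain ⟨a, ha, rfl⟩ := h.surjOn b hb
    exact ⟨a, ha, rfl⟩
  · exact (h'.adj_iff _ _ (h.mapsTo a ha) (h.mapsTo b hb)).trans (h.adj_iff a b ha hb)

end IsBallIso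

theorem dist_iso_apply (g : X ≃g Y) (a b : V) : Y.dist (g a) (g b) = X.dist a b := by
  by_cases h : X.Reachable a b
  · obtain ⟨p, hp⟩ := h.exists_walk_length_eq_dist
    obtain ⟨q, hq⟩ := (h.map g.toHom).exists_walk_length_eq_dist
    have h1 := SimpleGraph.dist_le (p.map g.toHom)
    have h2 := SimpleGraph.dist_le ((q.map g.symm.toHom).copy (g.symm_apply_apply a)
      (g.symm_apply_apply b))
    simp only [SimpleGraph.Walk.length_map, SimpleGraph.Walk.length_copy] at h1 h2
    exact le_antisymm (h1.trans hp.le) (h2.trans hq.le)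
  · rw [SimpleGraph.dist_eq_zero_of_not_reachable h, SimpleGraph.dist_eq_zero_of_not_reachable]
    rwa [SimpleGraph.Iso.reachable_iff]

theorem isChart_iso (g : X ≃g Y) (n : ℕ) (x : V) : IsChart X Y n x g := by
  refine ⟨fun a b _ _ h => g.injective h, fun a ha => by rwa [dist_iso_apply],
    fun b hb => ⟨g.symm b, ?_, g.apply_symm_apply b⟩, fun a b _ _ => g.map_adj_iff⟩
  rwa [← dist_iso_apply g, g.apply_symm_apply]

namespace IsChart

variable {n m : ℕ} {x x' : V} {φ : V → V'}

theorem restrict (hX : X.Connected) (hY : Y.Connected) (h : IsChart X Y n x φ)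
    (hx : X.dist x x' + m ≤ n) : IsChart X Y m x' φ := by
  have := IsBallIso.dist_le hX hY h (a := x) (b := x') (by simp; omega)
  exact IsBallIso.restrict hX hY h hx (by omega)

theorem comp {ψ : V' → V''} (h : IsChart X Y n x φ) (h' : IsChart Y Z n (φ x) ψ) :
    IsChart X Z n x (ψ ∘ φ) :=
  IsBallIso.comp h h'

theorem bijOn_neighborSet (h : IsChart X Y (n + 1) x φ) :
    Set.BijOn φ (X.neighborSet x) (Y.neighborSet (φ x)) := by
  have hb : ∀ a, X.Adj x a → X.dist x a ≤ n + 1 := fun a ha => by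
    rw [SimpleGraph.dist_eq_one_iff_adj.2 ha]; omega
  refine ⟨fun a ha => (h.adj_iff x a (by simp) (hb a ha)).2 ha,
    fun a ha b hb' => h.injOn a b (hb a ha) (hb b hb'), fun b hb' => ?_⟩
  have : Y.dist (φ x) b = 1 := SimpleGraph.dist_eq_one_iff_adj.2 hb'
  obtain ⟨a, ha, rfl⟩ := h.surjOn b (by omega)
  exact ⟨a, (h.adj_iff x a (by simp) ha).1 hb', rfl⟩

end IsChart

theorem finite_ball (hX : X.Connected) (hf : IsLocallyFinite X) (x : V) (n : ℕ) :
    {a | X.dist x a ≤ n}.Finite := by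
  induction n with
  | zero =>
    refine (Set.finite_singleton x).subset fun a ha => ?_
    exact (hX.dist_eq_zero_iff.1 (Nat.le_zero.1 ha)).symm
  | succ n ih =>
    refine (ih.union (ih.biUnion fun a _ => hf a)).subset fun a ha => ?_
    rcases Nat.lt_or_ge n (X.dist x a) with h | h
    · obtain ⟨c, hc, hca⟩ := exists_adj_dist_eq hX (le_antisymm ha h)
      exact Or.inr (Set.mem_biUnion (show X.dist x c ≤ n from hc.le) hca)
    · exact Or.inl h

/-- A locally bijective map from a nonempty graph to a connected graph is surjective. -/
theorem surjective_of_bijOn [Nonempty V] (hY : Y.Connected) {p : V → V'}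
    (h : ∀ x, Set.BijOn p (X.neighborSet x) (Y.neighborSet (p x))) : Function.Surjective p := by
  obtain ⟨x⟩ := ‹Nonempty V›
  intro y
  induction hn : Y.dist (p x) y generalizing y with
  | zero => exact ⟨x, hY.dist_eq_zero_iff.1 hn⟩
  | succ n ih =>
    obtain ⟨c, hc, hcy⟩ := exists_adj_dist_eq hY hn
    obtain ⟨a, rfl⟩ := ih c hc
    obtain ⟨b, -, hb⟩ := (h a).surjOn hcy
    exact ⟨b, hb⟩

end Charts

/-! ### Ball isomorphisms and automorphisms -/

section Compactness

variable {V : Type*} {X : SimpleGraph V}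

/-- A pointwise limit of isomorphisms between balls whose radii tend to infinity is an
automorphism. -/
theorem exists_iso_limit (hX : X.Connected) (hf : IsLocallyFinite X) {x y : V}
    {l : Ultrafilter ℕ} (hl : ∀ n : ℕ, ∀ᶠ k in (l : Filter ℕ), n ≤ k) {φ : ℕ → V → V}
    (hφ : ∀ᶠ k in (l : Filter ℕ), IsChart X X k x (φ k) ∧ φ k x = y) :
    ∃ g : X ≃g X, ∀ a, ∀ᶠ k in (l : Filter ℕ), φ k a = g a := by
  -- The values at `a` lie in a finite ball around `y`, so the ultrafilter selects one of them.
  -- Surjectivity below applies the same argument to preimages.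
  have hlim : ∀ a, ∃ b, ∀ᶠ k in (l : Filter ℕ), φ k a = b := fun a => by
    have h : ∀ᶠ k in (l : Filter ℕ), ∃ b ∈ {b | X.dist y b ≤ X.dist x a}, φ k a = b := by
      filter_upwards [hφ, hl (X.dist x a)] with k hk hk'
      refine ⟨φ k a, ?_, rfl⟩
      have := IsBallIso.dist_le hX hX hk.1 (a := x) (b := a) (by simpa using hk')
      rwa [hk.2] at this
    obtain ⟨b, -, hb⟩ :=
      (Ultrafilter.eventually_exists_mem_iff (finite_ball hX hf y (X.dist x a))).1 h
    exact ⟨b, hb⟩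
  choose g hg using hlim
  have hinj : Function.Injective g := fun a b hab => by
    obtain ⟨k, hk, ha, hb, hka, hkb⟩ :=
      (hφ.and ((hg a).and ((hg b).and ((hl (X.dist x a)).and (hl (X.dist x b)))))).exists
    exact hk.1.injOn a b hka hkb (by rw [ha, hb, hab])
  have hsurj : Function.Surjective g := fun b => by
    have h : ∀ᶠ k in (l : Filter ℕ), ∃ a ∈ {a | X.dist x a ≤ X.dist y b}, φ k a = b := by
      filter_upwards [hφ, hl (X.dist y b)] with k hk hk'
      obtain ⟨h1, h2⟩ := hk
      obtain ⟨a, ha, hab⟩ := (h1.restrict hX hX (x' := x) (m := X.dist y b)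
        (by simpa using hk')).surjOn b (by rw [h2])
      exact ⟨a, ha, hab⟩
    obtain ⟨a, -, ha⟩ :=
      (Ultrafilter.eventually_exists_mem_iff (finite_ball hX hf x (X.dist y b))).1 h
    obtain ⟨k, hk, hk'⟩ := (ha.and (hg a)).exists
    exact ⟨a, hk'.symm.trans hk⟩
  refine ⟨⟨Equiv.ofBijective g ⟨hinj, hsurj⟩, ?_⟩, hg⟩
  intro a b
  obtain ⟨k, hk, ha, hb, hka, hkb⟩ :=
    (hφ.and ((hg a).and ((hg b).and ((hl (X.dist x a)).and (hl (X.dist x b)))))).exists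
  have := hk.1.adj_iff a b hka hkb
  rw [ha, hb] at this
  exact this

/-- In a locally finite graph with cocompact automorphism group, isomorphisms between large balls
coincide with automorphisms on smaller concentric balls. -/
theorem exists_radius_forall_exists_iso (hX : X.Connected) (hf : IsLocallyFinite X)
    (hc : HasCocompactIsometryGroup X) (r : ℕ) :
    ∃ ρ, r ≤ ρ ∧ ∀ (x : V) (φ : V → V), IsChart X X ρ x φ →
      ∃ g : X ≃g X, ∀ z, X.dist x z ≤ r → φ z = g z := by
  -- Take counterexamples `φ k` on balls of radius `r + k` and move their centres and the images of
  -- these into the finite set `F` by automorphisms. The ultrafilter makes both constant, and the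
  -- limit automorphism agrees with some term on the whole `r`-ball.
  by_contra! hcon
  choose x φ hφ hne using fun k : ℕ => hcon (r + k) (Nat.le_add_right r k)
  obtain ⟨F, hF⟩ := hc
  choose a ha h hh using fun k => hF (x k)
  choose b hb j hj using fun k => hF (φ k (x k))
  let l : Ultrafilter ℕ := Ultrafilter.of Filter.atTop
  have hl : ∀ n : ℕ, ∀ᶠ k in (l : Filter ℕ), n ≤ k := fun n =>
    Ultrafilter.of_le _ (Filter.eventually_ge_atTop n)
  obtain ⟨a₀, -, ha₀⟩ := (Ultrafilter.eventually_exists_mem_iff (f := l)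
    (P := fun c k => a k = c) F.finite_toSet).1 (Filter.Eventually.of_forall fun k => ⟨a k, ha k, rfl⟩)
  obtain ⟨b₀, -, hb₀⟩ := (Ultrafilter.eventually_exists_mem_iff (f := l)
    (P := fun c k => b k = c) F.finite_toSet).1 (Filter.Eventually.of_forall fun k => ⟨b k, hb k, rfl⟩)
  let ψ : ℕ → V → V := fun k => (j k).symm ∘ φ k ∘ h k
  have hψ : ∀ᶠ k in (l : Filter ℕ), IsChart X X k a₀ (ψ k) ∧ ψ k a₀ = b₀ := by
    filter_upwards [ha₀, hb₀] with k hka hkb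
    subst hka hkb
    constructor
    · have h1 : IsChart X X (r + k) (a k) (φ k ∘ h k) :=
        IsChart.comp (isChart_iso (h k) (r + k) (a k)) (by rw [hh]; exact hφ k)
      have h2 : IsChart X X (r + k) (a k) (ψ k) := IsChart.comp h1 (isChart_iso (j k).symm (r + k) _)
      exact h2.restrict hX hX (by simp)
    · change (j k).symm (φ k (h k (a k))) = b k
      rw [hh, ← hj, RelIso.symm_apply_apply]
  obtain ⟨g, hg⟩ := exists_iso_limit hX hf hl hψ
  have hall : ∀ᶠ k in (l : Filter ℕ), ∀ z ∈ {z | X.dist a₀ z ≤ r}, ψ k z = g z :=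
    (Filter.eventually_all_finite (finite_ball hX hf a₀ r)).2 fun z _ => hg z
  obtain ⟨k, hk, hka⟩ := (hall.and ha₀).exists
  obtain ⟨z, hz, hzne⟩ := hne k (((h k).symm.trans g).trans (j k))
  refine hzne ?_
  have h3 := hk ((h k).symm z) (by
    change X.dist a₀ ((h k).symm z) ≤ r
    rwa [← dist_iso_apply (h k), RelIso.apply_symm_apply, ← hka, hh])
  change (j k).symm (φ k (h k ((h k).symm z))) = _ at h3
  rw [RelIso.apply_symm_apply] at h3
  change φ k z = j k (g ((h k).symm z))
  rw [← h3, RelIso.apply_symm_apply]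

end Compactness

/-! ### Gluing charts along a tree -/

section Gluing

variable {V V' W : Type*} {X : SimpleGraph V} {Y : SimpleGraph V'} {T : SimpleGraph W}

/-- A quasi-isometry with natural constants, and with the two distances compared
multiplicatively. -/
structure IsCoarse (X : SimpleGraph V) (T : SimpleGraph W) (c : ℕ) (q : V → W) : Prop where
  surj : ∀ t, ∃ x, T.dist t (q x) ≤ c
  lower : ∀ a b, X.dist a b ≤ c * (T.dist (q a) (q b) + c)
  upper : ∀ a b, T.dist (q a) (q b) ≤ c * X.dist a b + c

theorem IsQuasiIsometry.exists_isCoarse {C K : ℝ} {q : V → W} (h : IsQuasiIsometry X T C K q) :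
    ∃ c, IsCoarse X T c q := by
  obtain ⟨c, hc⟩ := exists_nat_ge (max C K)
  have hC : C ≤ c := (le_max_left _ _).trans hc
  have hK : K ≤ c := (le_max_right _ _).trans hc
  have h1 := h.one_le
  refine ⟨c, fun t => ?_, fun a b => ?_, fun a b => ?_⟩
  · obtain ⟨x, hx⟩ := h.coarselySurjective t
    exact ⟨x, by exact_mod_cast hx.trans hK⟩
  · have h2 := h.lower a b
    have h3 : (X.dist a b : ℝ) ≤ C * (T.dist (q a) (q b) + K) := by
      have h4 : C⁻¹ * (X.dist a b : ℝ) ≤ T.dist (q a) (q b) + K := by linarith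
      rwa [inv_mul_le_iff₀ (by linarith)] at h4
    have h5 : C * ((T.dist (q a) (q b) : ℝ) + K) ≤ c * (T.dist (q a) (q b) + c) := by
      have := h.nonneg
      gcongr
    exact_mod_cast h3.trans h5
  · have h2 := h.upper a b
    have h5 : C * (X.dist a b : ℝ) + K ≤ c * X.dist a b + c := by gcongr
    exact_mod_cast h2.trans h5

/-- The neighbour of `v` that is closer to `u` is unique in a tree. -/
theorem unique_adj_dist_of_isTree (hT : T.IsTree) {u v a b : W} (ha : T.Adj a v) (hb : T.Adj b v)
    (hda : T.dist u v = T.dist u a + 1) (hdb : T.dist u v = T.dist u b + 1) : a = b := by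
  obtain ⟨p, hp, hpl⟩ := hT.connected.exists_path_of_dist u a
  obtain ⟨q, hq, hql⟩ := hT.connected.exists_path_of_dist u b
  have h1 : (p.concat ha).IsPath :=
    SimpleGraph.Walk.isPath_of_length_eq_dist _ (by rw [SimpleGraph.Walk.length_concat]; omega)
  have h2 : (q.concat hb).IsPath :=
    SimpleGraph.Walk.isPath_of_length_eq_dist _ (by rw [SimpleGraph.Walk.length_concat]; omega)
  have h3 := congrArg Subtype.val ((hT.isAcyclic.subsingleton_path _ _).elim ⟨_, h1⟩ ⟨_, h2⟩)
  have h4 := congrArg SimpleGraph.Walk.penultimate h3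
  simpa using h4

/-- Recursive choice along a tree: if every value at a vertex can be moved to each neighbour,
then there is a choice of values at all vertices, with a given value at the root, that is
compatible along every edge. -/
theorem exists_forall_adj_of_isTree (hT : T.IsTree) {α : Type*} (P : W → α → Prop)
    (Q : W → W → α → α → Prop) (t₀ : W) (a₀ : α) (h₀ : P t₀ a₀)
    (step : ∀ s t a, T.Adj s t → P s a → ∃ b, P t b ∧ Q s t a b) :
    ∃ F : W → α, F t₀ = a₀ ∧ (∀ t, P t (F t)) ∧
      ∀ s t, T.Adj s t → Q s t (F s) (F t) ∨ Q t s (F t) (F s) := by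
  have hpar : ∀ t, ∃ s, T.dist t₀ t ≠ 0 → T.Adj s t ∧ T.dist t₀ t = T.dist t₀ s + 1 := fun t => by
    rcases Nat.eq_zero_or_eq_succ_pred (T.dist t₀ t) with h | h
    · exact ⟨t, fun h' => absurd h h'⟩
    · obtain ⟨s, hs, hst⟩ := exists_adj_dist_eq hT.connected h
      exact ⟨s, fun _ => ⟨hst, by omega⟩⟩
  choose π hπ using hpar
  have hstep : ∀ s t a, ∃ b, T.Adj s t → P s a → P t b ∧ Q s t a b := fun s t a => by
    by_cases h : T.Adj s t ∧ P s a
    · obtain ⟨b, hb⟩ := step s t a h.1 h.2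
      exact ⟨b, fun _ _ => hb⟩
    · exact ⟨a, fun h1 h2 => absurd ⟨h1, h2⟩ h⟩
  choose σ hσ using hstep
  -- `G n t` is meaningful only for `t` at distance `n` from the root.
  let G : ℕ → W → α := fun n => Nat.rec (fun _ => a₀) (fun _ g t => σ (π t) t (g (π t))) n
  have hG : ∀ n t, T.dist t₀ t = n → P t (G n t) := fun n => by
    induction n with
    | zero =>
      intro t ht
      obtain rfl := hT.connected.dist_eq_zero_iff.1 ht
      exact h₀
    | succ n ih =>
      intro t ht
      obtain ⟨h1, h2⟩ := hπ t (by omega)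
      exact (hσ (π t) t _ h1 (ih _ (by omega))).1
  have hQ : ∀ s t, T.Adj s t → T.dist t₀ t = T.dist t₀ s + 1 →
      Q s t (G (T.dist t₀ s) s) (G (T.dist t₀ t) t) := fun s t hst hd => by
    obtain ⟨h1, h2⟩ := hπ t (by omega)
    obtain rfl := unique_adj_dist_of_isTree hT hst h1 hd h2
    rw [hd]
    exact (hσ (π t) t _ h1 (hG _ _ rfl)).2
  refine ⟨fun t => G (T.dist t₀ t) t, by simp [G], fun t => hG _ t rfl, fun s t hst => ?_⟩
  rcases hT.dist_eq_dist_add_one_of_adj t₀ hst with h | h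
  · exact Or.inr (hQ t s hst.symm h)
  · exact Or.inl (hQ s t hst h)

/-- If every vertex of `Y` is the centre of a large ball isomorphic to a ball of `X`, then a chart
can be moved to a nearby centre without changing it on a given ball. -/
theorem exists_chart_move (hX : X.Connected) (hY : Y.Connected) {r ρ D : ℕ} (hr : r ≤ ρ)
    (hρ : ∀ (x : V) (φ : V → V), IsChart X X ρ x φ →
      ∃ g : X ≃g X, ∀ z, X.dist x z ≤ r → φ z = g z)
    (hloc : ∀ y, ∃ x φ, IsChart X Y (ρ + D) x φ ∧ φ x = y) {x x' : V} {φ : V → V'}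
    (hφ : IsChart X Y (ρ + D) x φ) (hx : X.dist x x' ≤ D) :
    ∃ ψ, IsChart X Y (ρ + D) x' ψ ∧ ∀ z, X.dist x' z ≤ r → ψ z = φ z := by
  have h1 : IsChart X Y ρ x' φ := hφ.restrict hX hY (by omega)
  obtain ⟨w, ψ, hψ, hw⟩ := hloc (φ x')
  have h2 : IsChart X Y ρ w ψ := hψ.restrict hX hY (by simp)
  obtain ⟨χ, hχ, hl, hr'⟩ := IsBallIso.exists_inverse h2
  rw [hw] at hχ
  have hwx : χ (φ x') = w := by rw [← hw, hl w (by simp)]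
  -- The transition map only has radius `ρ`, but the automorphism `g` that it yields is global, so
  -- `ψ ∘ g` keeps the full radius `ρ + D` of `ψ`.
  have h3 : IsChart X X ρ x' (χ ∘ φ) := by
    have := IsBallIso.comp h1 hχ
    rwa [← hwx] at this
  obtain ⟨g, hg⟩ := hρ x' _ h3
  have hgx : g x' = w := by rw [← hg x' (by simp)]; exact hwx
  refine ⟨ψ ∘ g, IsChart.comp (isChart_iso g _ x') (by rw [hgx]; exact hψ), fun z hz => ?_⟩
  change ψ (g z) = φ z
  rw [← hg z hz]
  refine hr' _ ?_
  rw [hw]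
  exact h1.mapsTo z (hz.trans hr)

/-- Charts with values in a graph that is locally `X` extend to coverings when `X` is coarsely
equivalent to a tree. -/
theorem exists_covering_extension (hX : X.Connected) (hf : IsLocallyFinite X)
    (hc : HasCocompactIsometryGroup X) (hT : T.IsTree) {c : ℕ} {q : V → W}
    (hq : IsCoarse X T c q) (r : ℕ) :
    ∃ N, r ≤ N ∧ ∀ {V' : Type v} (Y : SimpleGraph V'), Y.Connected →
      (∀ y, ∃ x φ, IsChart X Y N x φ ∧ φ x = y) → ∀ x φ, IsChart X Y N x φ →
        ∃ p : V → V', IsCovering X Y p ∧ ∀ z, X.dist x z ≤ r → p z = φ z := by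
  -- `L` bounds the distance in `T` between the images of vertices at distance at most `r` or at
  -- most `1`; `D` bounds the distance between the centres of charts at adjacent tree vertices. A
  -- vertex whose image is within `L` of `t` lies within `E - 1` of the centre `x t`, which leaves
  -- room for its neighbours.
  set L := c * r + 2 * c with hL
  set D := c * (2 * c + 1 + c) with hD
  set E := c * (L + 2 * c) + 1 with hE
  obtain ⟨ρ, hrρ, hρ⟩ := exists_radius_forall_exists_iso hX hf hc (E + D + r)
  refine ⟨ρ + D, by omega, fun {V'} Y hY hloc x₀ φ₀ hφ₀ => ?_⟩
  -- The centre at the root must be exactly `x₀`, so that the given chart `φ₀` can start the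
  -- recursion.
  have hbase : ∀ t, ∃ x, T.dist t (q x) ≤ c ∧ (t = q x₀ → x = x₀) := fun t => by
    by_cases h : t = q x₀
    · exact ⟨x₀, by simp [h], fun _ => rfl⟩
    · obtain ⟨x, hx⟩ := hq.surj t
      exact ⟨x, hx, fun h' => absurd h' h⟩
  choose x hx hx₀ using hbase
  have hxadj : ∀ s t, T.Adj s t → X.dist (x s) (x t) ≤ D := fun s t hst => by
    refine (hq.lower _ _).trans (Nat.mul_le_mul_left _ (Nat.add_le_add_right ?_ _))
    have h1 : T.dist (q (x s)) (q (x t)) ≤ T.dist (q (x s)) s + T.dist s (q (x t)) :=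
      hT.connected.dist_triangle
    have h2 : T.dist s (q (x t)) ≤ T.dist s t + T.dist t (q (x t)) := hT.connected.dist_triangle
    have h3 := SimpleGraph.dist_eq_one_iff_adj.2 hst
    have h4 := hx s
    have h5 := hx t
    rw [SimpleGraph.dist_comm] at h4
    omega
  have hxz : ∀ t z, T.dist t (q z) ≤ L → X.dist (x t) z + 1 ≤ E := fun t z h => by
    refine Nat.add_le_add_right ((hq.lower _ _).trans (Nat.mul_le_mul_left _ ?_)) _
    have h1 : T.dist (q (x t)) (q z) ≤ T.dist (q (x t)) t + T.dist t (q z) :=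
      hT.connected.dist_triangle
    have h4 := hx t
    rw [SimpleGraph.dist_comm] at h4
    omega
  obtain ⟨F, hF₀, hF, hFadj⟩ := exists_forall_adj_of_isTree hT
    (fun t φ => IsChart X Y (ρ + D) (x t) φ)
    (fun s t φ ψ => ∀ z, X.dist (x t) z ≤ E + D → ψ z = φ z) (q x₀) φ₀
    (by rw [hx₀ _ rfl]; exact hφ₀) (fun s t φ hst hφ => by
      obtain ⟨ψ, h1, h2⟩ := exists_chart_move hX hY hrρ hρ hloc hφ (hxadj s t hst)
      exact ⟨ψ, h1, fun z hz => h2 z (by omega)⟩)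
  -- The recursion gives agreement around the child's centre only; the extra margin `D` in the
  -- radius makes it symmetric.
  have hagree : ∀ s t, T.Adj s t → ∀ z, X.dist (x t) z ≤ E → F s z = F t z := fun s t hst z hz => by
    rcases hFadj s t hst with h | h
    · exact (h z (by omega)).symm
    · refine h z ?_
      have h1 : X.dist (x s) z ≤ X.dist (x s) (x t) + X.dist (x t) z := hX.dist_triangle
      have := hxadj s t hst
      omega
  -- Walk from `q z` to `t` along a geodesic of `T`: every chart on the way is centred close enough
  -- to `z` to contain `z'` in its zone of agreement.
  have hstar : ∀ z z', X.dist z z' ≤ 1 → ∀ t, T.dist (q z) t ≤ L → F t z' = F (q z) z' := by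
    intro z z' hzz' t ht
    induction hn : T.dist (q z) t generalizing t with
    | zero => rw [hT.connected.dist_eq_zero_iff.1 hn]
    | succ n ih =>
      obtain ⟨s, hs, hst⟩ := exists_adj_dist_eq hT.connected hn
      rw [← ih s (by omega) hs]
      refine (hagree s t hst z' ?_).symm
      have h1 : X.dist (x t) z' ≤ X.dist (x t) z + X.dist z z' := hX.dist_triangle
      have h2 := hxz t z (by rw [SimpleGraph.dist_comm]; exact ht)
      omega
  -- Near `z` the glued map coincides with the single chart `F (q z)`, hence is locally bijective.
  have hp : ∀ z z', X.dist z z' ≤ 1 → F (q z') z' = F (q z) z' := fun z z' h => by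
    refine (hstar z' z' (by simp) (q z) ?_).symm
    refine (hq.upper _ _).trans ?_
    rw [SimpleGraph.dist_comm] at h
    have := Nat.mul_le_mul_left c h
    omega
  have hbij : ∀ z, Set.BijOn (fun z => F (q z) z) (X.neighborSet z)
      (Y.neighborSet (F (q z) z)) := fun z => by
    have h1 : IsChart X Y (0 + 1) z (F (q z)) := by
      refine (hF (q z)).restrict hX hY ?_
      have := hxz (q z) z (by simp)
      omega
    refine h1.bijOn_neighborSet.congr fun z' hz' => (hp z z' ?_).symm
    exact (SimpleGraph.dist_eq_one_iff_adj.2 hz').le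
  have : Nonempty V := ⟨x₀⟩
  refine ⟨fun z => F (q z) z, ⟨surjective_of_bijOn hY hbij, hbij⟩, fun z hz => ?_⟩
  rw [← hF₀]
  refine (hstar z z (by simp) (q x₀) ?_).symm
  have h1 := hq.upper z x₀
  rw [SimpleGraph.dist_comm (G := X)] at h1
  have := Nat.mul_le_mul_left c hz
  omega

end Gluing

/-! ### Thin triangles and almost concentric balls -/

section CoarseSeparation

open SimpleGraph

variable {V W : Type*} {X : SimpleGraph V} {T : SimpleGraph W}

theorem isPath_append {u v w : W} {p : T.Walk u v} {q : T.Walk v w} (hp : p.IsPath)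
    (hq : q.IsPath) (h : ∀ x ∈ p.support, x ∈ q.support → x = v) : (p.append q).IsPath := by
  rw [Walk.isPath_def, Walk.support_append, List.nodup_append]
  have hq' := (Walk.isPath_def q).1 hq
  rw [← Walk.cons_tail_support, List.nodup_cons] at hq'
  refine ⟨(Walk.isPath_def p).1 hp, hq'.2, fun x hx y hy hxy => ?_⟩
  subst hxy
  obtain rfl := h x hx (List.mem_of_mem_tail hy)
  exact hq'.1 hy

theorem mem_support_of_isPath (hT : T.IsTree) {a b c : W} {p : T.Walk a b} (hp : p.IsPath)
    (hc : c ∈ p.support) (q : T.Walk a b) : c ∈ q.support := by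
  classical
  have h := congrArg Subtype.val
    ((hT.isAcyclic.subsingleton_path _ _).elim ⟨p, hp⟩ ⟨q.bypass, q.bypass_isPath⟩)
  change p = q.bypass at h
  exact q.support_bypass_subset_support (h ▸ hc)

/-- Any three vertices of a tree have a median. -/
theorem exists_median (hT : T.IsTree) (a b s : W) :
    ∃ c, (∀ p : T.Walk a s, c ∈ p.support) ∧ (∀ p : T.Walk s b, c ∈ p.support) ∧
      ∀ p : T.Walk a b, c ∈ p.support := by
  classical
  obtain ⟨P, hP, -⟩ := hT.connected.exists_path_of_dist a b
  obtain ⟨c, hc, hmin⟩ := P.support.toFinset.exists_min_image (fun c => T.dist s c)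
    ⟨a, by simp⟩
  rw [List.mem_toFinset] at hc
  obtain ⟨g, hg, hgl⟩ := hT.connected.exists_path_of_dist s c
  -- As `c` is the point of `P` nearest to `s`, the geodesic `g` meets `P` only at its end.
  have hmeet : ∀ x ∈ g.support, x ∈ P.support → x = c := fun x hx hxP => by
    have h1 := hmin x (List.mem_toFinset.2 hxP)
    have h2 := congrArg Walk.length (g.take_spec hx)
    rw [Walk.length_append] at h2
    have h3 := dist_le (g.takeUntil x hx)
    exact Walk.eq_of_length_eq_zero (p := g.dropUntil x hx) (by omega)
  have h1 : (g.append (P.dropUntil c hc)).IsPath := isPath_append hg (hP.dropUntil hc)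
    fun x hx hx' => hmeet x hx (P.support_dropUntil_subset_support hc hx')
  have h2 : (g.append (P.takeUntil c hc).reverse).IsPath := isPath_append hg
    ((hP.takeUntil hc).reverse) fun x hx hx' => hmeet x hx
      (P.support_takeUntil_subset_support hc (by simpa using hx'))
  refine ⟨c, fun p => ?_, mem_support_of_isPath hT h1 (by simp), mem_support_of_isPath hT hP hc⟩
  have := mem_support_of_isPath hT h2 (c := c) (by simp) p.reverse
  simpa using this

theorem dist_add_dist_of_mem_support (hX : X.Connected) {a b z : V} {p : X.Walk a b}
    (hp : p.length = X.dist a b) (hz : z ∈ p.support) : X.dist a z + X.dist z b = X.dist a b := by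
  classical
  have h2 := congrArg Walk.length (p.take_spec hz)
  rw [Walk.length_append] at h2
  have h3 := dist_le (p.takeUntil z hz)
  have h4 := dist_le (p.dropUntil z hz)
  have h5 : X.dist a b ≤ X.dist a z + X.dist z b := hX.dist_triangle
  omega

/-- The image of a walk under a coarse map can be completed to a nearby walk. -/
theorem exists_walk_near (hT : T.Connected) {q : V → W} {J : ℕ}
    (hq : ∀ a b, X.Adj a b → T.dist (q a) (q b) ≤ J) {a b : V} (p : X.Walk a b) :
    ∃ P : T.Walk (q a) (q b), ∀ t ∈ P.support, ∃ z ∈ p.support, T.dist (q z) t ≤ J := by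
  induction p with
  | @nil a => exact ⟨.nil, fun t ht => by
    obtain rfl := Walk.mem_support_nil_iff.1 ht
    exact ⟨a, by simp, by simp⟩⟩
  | @cons a b d h p ih =>
    obtain ⟨P, hP⟩ := ih
    obtain ⟨Q, hQ⟩ := hT.exists_walk_length_eq_dist (q a) (q b)
    refine ⟨Q.append P, fun t ht => ?_⟩
    rcases Walk.mem_support_append_iff _ _ |>.1 ht with ht | ht
    · refine ⟨a, by simp, ?_⟩
      have := dist_add_dist_of_mem_support hT hQ ht
      have := hq a b h
      omega
    · obtain ⟨z, hz, hzt⟩ := hP t ht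
      exact ⟨z, by simp [hz], hzt⟩

/-- In a graph that is coarsely equivalent to a tree, the three sides of every triangle of walks
come close to each other. -/
theorem IsCoarse.exists_thin (hT : T.IsTree) {c : ℕ} {q : V → W} (hq : IsCoarse X T c q) :
    ∃ δ, ∀ {a m b : V} (p₁ : X.Walk a m) (p₂ : X.Walk m b) (p₃ : X.Walk a b),
      ∃ u ∈ p₁.support, ∃ v ∈ p₂.support, ∃ w ∈ p₃.support, X.dist u v ≤ δ ∧ X.dist u w ≤ δ := by
  have hadj : ∀ a b, X.Adj a b → T.dist (q a) (q b) ≤ 2 * c := fun a b h => by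
    have := hq.upper a b
    rw [dist_eq_one_iff_adj.2 h] at this
    omega
  have hclose : ∀ t x y, T.dist (q x) t ≤ 2 * c → T.dist (q y) t ≤ 2 * c →
      X.dist x y ≤ c * (4 * c + c) := fun t x y hx hy => by
    refine (hq.lower x y).trans (Nat.mul_le_mul_left _ (Nat.add_le_add_right ?_ _))
    have : T.dist (q x) (q y) ≤ T.dist (q x) t + T.dist t (q y) := hT.connected.dist_triangle
    rw [dist_comm] at hy
    omega
  refine ⟨c * (4 * c + c), fun {a m b} p₁ p₂ p₃ => ?_⟩
  -- Each side, pushed to `T` and completed to a walk, must pass through the median of the three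
  -- corners.
  obtain ⟨t, h1, h2, h3⟩ := exists_median hT (q a) (q b) (q m)
  obtain ⟨P₁, hP₁⟩ := exists_walk_near hT.connected hadj p₁
  obtain ⟨P₂, hP₂⟩ := exists_walk_near hT.connected hadj p₂
  obtain ⟨P₃, hP₃⟩ := exists_walk_near hT.connected hadj p₃
  obtain ⟨u, hu, hut⟩ := hP₁ t (h1 P₁)
  obtain ⟨v, hv, hvt⟩ := hP₂ t (h2 P₂)
  obtain ⟨w, hw, hwt⟩ := hP₃ t (h3 P₃)
  exact ⟨u, hu, v, hv, w, hw, hclose t u v hut hvt, hclose t u w hut hwt⟩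

theorem exists_dist_eq_of_le (hX : X.Connected) {a b : V} {k : ℕ} (hk : k ≤ X.dist a b) :
    ∃ m, X.dist a m = k ∧ X.dist a m + X.dist m b = X.dist a b := by
  obtain ⟨p, hp⟩ := hX.exists_walk_length_eq_dist a b
  have h := dist_add_dist_of_mem_support hX hp (p.getVert_mem_support k)
  refine ⟨p.getVert k, ?_, h⟩
  have h1 := dist_le (p.take k)
  have h2 := dist_le (p.drop k)
  rw [Walk.take_length] at h1
  rw [Walk.drop_length] at h2
  omega

theorem exists_dist_iso_le (hc : HasCocompactIsometryGroup X) :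
    ∃ D, ∀ x m, ∃ g : X ≃g X, X.dist x (g m) ≤ D := by
  obtain ⟨F, hF⟩ := hc
  obtain ⟨D, hD⟩ := ((F ×ˢ F).image fun a => X.dist a.1 a.2).bddAbove
  refine ⟨D, fun x m => ?_⟩
  obtain ⟨a, ha, h, rfl⟩ := hF x
  obtain ⟨b, hb, k, rfl⟩ := hF m
  refine ⟨k.symm.trans h, ?_⟩
  change X.dist (h a) (h (k.symm (k b))) ≤ D
  rw [RelIso.symm_apply_apply, dist_iso_apply]
  exact hD (Finset.mem_coe.2 (Finset.mem_image.2 ⟨(a, b), Finset.mk_mem_product ha hb, rfl⟩))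

/-- In a cocompact quasi-tree, a ball that is contained in another ball of the same radius is
almost concentric with it. -/
theorem exists_dist_le_of_ball_subset (hX : X.Connected) (hc : HasCocompactIsometryGroup X)
    (hT : T.IsTree) {c : ℕ} {q : V → W} (hq : IsCoarse X T c q) :
    ∃ B, ∀ x x' n, (∀ z, X.dist x z ≤ n → X.dist x' z ≤ n) → X.dist x x' ≤ B := by
  by_cases hb : ∃ B, ∀ x x', X.dist x x' ≤ B
  · obtain ⟨B, hB⟩ := hb
    exact ⟨B, fun x x' _ _ => hB x x'⟩
  push Not at hb
  obtain ⟨D, hD⟩ := exists_dist_iso_le hc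
  obtain ⟨δ, hδ⟩ := hq.exists_thin hT
  refine ⟨2 * D + 4 * δ, fun x x' n h => ?_⟩
  rcases le_total n D with hn | hn
  · have := h x (by simp)
    rw [dist_comm]
    omega
  obtain ⟨N, rfl⟩ := Nat.exists_eq_add_of_le hn
  -- By unboundedness and cocompactness, some geodesic of length `2 * N`, with `N = n - D`, has its
  -- midpoint `m` within `D` of `x`. Its ends then lie in the ball around `x`, hence in the one
  -- around `x'`.
  obtain ⟨a₀, b₁, hab⟩ := hb (2 * N)
  obtain ⟨b₀, hb₀, -⟩ := exists_dist_eq_of_le hX hab.le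
  obtain ⟨m₀, hm₀, hm₁⟩ := exists_dist_eq_of_le hX (a := a₀) (b := b₀) (k := N) (by omega)
  obtain ⟨g, hg⟩ := hD x m₀
  obtain ⟨a, b, m, ham, hmb, hab, hxm⟩ : ∃ a b m, X.dist a m = N ∧ X.dist m b = N ∧
      X.dist a b = 2 * N ∧ X.dist x m ≤ D :=
    ⟨g a₀, g b₀, g m₀, by rwa [dist_iso_apply], by rw [dist_iso_apply]; omega,
      by rwa [dist_iso_apply], hg⟩
  have hxa : X.dist x' a ≤ D + N := h a <| by
    have : X.dist x a ≤ X.dist x m + X.dist m a := hX.dist_triangle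
    rw [dist_comm] at ham
    omega
  have hxb : X.dist x' b ≤ D + N := h b <| by
    have : X.dist x b ≤ X.dist x m + X.dist m b := hX.dist_triangle
    omega
  obtain ⟨p₁, hp₁⟩ := hX.exists_walk_length_eq_dist a m
  obtain ⟨p₂, hp₂⟩ := hX.exists_walk_length_eq_dist m b
  obtain ⟨p₃, hp₃⟩ := hX.exists_walk_length_eq_dist x' a
  obtain ⟨p₄, hp₄⟩ := hX.exists_walk_length_eq_dist x' b
  -- The halves of a geodesic approach each other only near `m`, so `w` is within `2 * δ` of `m`. It
  -- also lies on a geodesic of length at most `D + N` from `x'` to an end, at least `N - 2 * δ`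
  -- before that end, so it is within `D + 2 * δ` of `x'`.
  obtain ⟨u, hu, v, hv, w, hw, huv, huw⟩ := hδ p₁ p₂ (p₃.reverse.append p₄)
  have h1 := dist_add_dist_of_mem_support hX hp₁ hu
  have h2 := dist_add_dist_of_mem_support hX hp₂ hv
  have h3 : X.dist a b ≤ X.dist a u + X.dist u b := hX.dist_triangle
  have h4 : X.dist u b ≤ X.dist u v + X.dist v b := hX.dist_triangle
  have h5 : X.dist m w ≤ X.dist m u + X.dist u w := hX.dist_triangle
  have h6 : X.dist m u = X.dist u m := dist_comm
  have hw' : X.dist x' w ≤ D + 2 * δ := by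
    rw [Walk.mem_support_append_iff, Walk.support_reverse, List.mem_reverse] at hw
    rcases hw with hw | hw
    · have h7 := dist_add_dist_of_mem_support hX hp₃ hw
      have h8 : X.dist m a ≤ X.dist m w + X.dist w a := hX.dist_triangle
      have h9 : X.dist m a = X.dist a m := SimpleGraph.dist_comm
      omega
    · have h7 := dist_add_dist_of_mem_support hX hp₄ hw
      have h8 : X.dist m b ≤ X.dist m w + X.dist w b := hX.dist_triangle
      omega
  have h9 : X.dist x x' ≤ X.dist x m + X.dist m x' := hX.dist_triangle
  have h10 : X.dist m x' ≤ X.dist m w + X.dist w x' := hX.dist_triangle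
  have h11 : X.dist w x' = X.dist x' w := SimpleGraph.dist_comm
  omega

end CoarseSeparation

/-! ### From intrinsic isometries to charts -/

section BallIsometries

variable {V : Type u} {V' : Type v} {X : SimpleGraph V} {Y : SimpleGraph V'}

theorem mem_ball_natCast {x a : V} {n : ℕ} : a ∈ ball X x n ↔ X.dist x a ≤ n := by
  simp [ball]

theorem BallIsometry.adj_iff {x : V} {y : V'} {R : ℝ} (f : BallIsometry X Y x y R)
    (a b : ball X x R) : Y.Adj (f.toEquiv a) (f.toEquiv b) ↔ X.Adj a b := by
  have h := f.isometry a b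
  have h1 : (X.induce (ball X x R)).Adj a b ↔ X.Adj a b := Iff.rfl
  have h2 : (Y.induce (ball Y y R)).Adj (f.toEquiv a) (f.toEquiv b) ↔
    Y.Adj (f.toEquiv a) (f.toEquiv b) := Iff.rfl
  rw [← h1, ← h2, ← SimpleGraph.dist_eq_one_iff_adj, ← SimpleGraph.dist_eq_one_iff_adj]
  rw [ballDist, ballDist] at h
  rw [h]

theorem BallIsometry.exists_isBallIso {x : V} {y : V'} {n : ℕ} (f : BallIsometry X Y x y n) :
    ∃ φ, IsBallIso X Y x y n φ ∧ ∀ z : ball X x n, φ z = f.toEquiv z := by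
  classical
  let φ : V → V' := fun z => if h : z ∈ ball X x n then f.toEquiv ⟨z, h⟩ else y
  have hφ : ∀ z : ball X x n, φ z = f.toEquiv z := fun z => dif_pos z.2
  have hφ' : ∀ z (h : X.dist x z ≤ n), φ z = f.toEquiv ⟨z, mem_ball_natCast.2 h⟩ :=
    fun z h => hφ ⟨z, mem_ball_natCast.2 h⟩
  refine ⟨φ, ⟨fun a b ha hb hab => ?_, fun a ha => ?_, fun b hb => ?_, fun a b ha hb => ?_⟩, hφ⟩
  · rw [hφ' a ha, hφ' b hb] at hab
    exact congrArg Subtype.val (f.toEquiv.injective (Subtype.ext hab))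
  · rw [hφ' a ha]
    exact mem_ball_natCast.1 (f.toEquiv ⟨a, _⟩).2
  · refine ⟨f.toEquiv.symm ⟨b, mem_ball_natCast.2 hb⟩,
      mem_ball_natCast.1 (f.toEquiv.symm ⟨b, _⟩).2, ?_⟩
    rw [hφ, Equiv.apply_symm_apply]
  · rw [hφ' a ha, hφ' b hb]
    exact f.adj_iff _ _

/-- If balls contained in balls of the same radius are almost concentric in `X`, then the
isomorphisms between balls almost preserve the centres. -/
theorem IsBallIso.dist_center_le (hX : X.Connected) (hY : Y.Connected) {B : ℕ}
    (hB : ∀ x x' n, (∀ z, X.dist x z ≤ n → X.dist x' z ≤ n) → X.dist x x' ≤ B)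
    {x : V} {y : V'} {n : ℕ} {φ : V → V'} (h : IsBallIso X Y x y n φ) :
    (∃ x', X.dist x x' ≤ B ∧ φ x' = y) ∧ Y.dist y (φ x) ≤ B := by
  obtain ⟨ψ, hψ, hl, hr⟩ := h.exists_inverse
  -- The inverse does not increase distances from the centre `y`, so the ball around `x` lies in the
  -- ball of the same radius around `ψ y`.
  have hxψ : X.dist x (ψ y) ≤ B := hB x (ψ y) n fun z hz => by
    have h1 := h.mapsTo z hz
    have h2 := hψ.dist_le hY hX (a := y) (b := φ z) (by simpa using h1)
    rw [hl z hz] at h2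
    exact h2.trans h1
  have hn : X.dist x (ψ y) ≤ n := hψ.mapsTo y (by simp)
  have hy : φ (ψ y) = y := hr y (by simp)
  refine ⟨⟨ψ y, hxψ, hy⟩, ?_⟩
  have h1 := h.dist_le hX hY (a := x) (b := ψ y) (by simpa using hn)
  rw [hy, SimpleGraph.dist_comm] at h1
  exact h1.trans hxψ

/-- Ball isometries of radius `N + B` move centres by at most `B`, so they restrict to charts of
radius `N`, to which the gluing applies. -/
theorem isSLGRigid_of_isCoarse {W : Type*} {T : SimpleGraph W} (hX : IsGraph X)
    (hc : HasCocompactIsometryGroup X) (hT : T.IsTree) {c : ℕ} {q : V → W}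
    (hq : IsCoarse X T c q) : IsSLGRigid.{u, v} X := by
  refine ⟨0, fun r _ _ => ?_⟩
  obtain ⟨r', hr'⟩ := exists_nat_ge r
  obtain ⟨N, hN, hext⟩ := exists_covering_extension.{v} hX.connected hX.locallyFinite hc hT hq r'
  obtain ⟨B, hB⟩ := exists_dist_le_of_ball_subset hX.connected hc hT hq
  refine ⟨((N + B : ℕ) : ℝ), hr'.trans (by exact_mod_cast hN.trans (Nat.le_add_right N B)),
    fun V' Y hY hloc x y f => ?_⟩
  obtain ⟨φ, hφ, hφf⟩ := f.exists_isBallIso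
  have hcenter := hφ.dist_center_le hX.connected hY.connected hB
  have hφx : IsChart X Y N x φ := hφ.restrict hX.connected hY.connected (by simp)
    (by have := hcenter.2; omega)
  obtain ⟨p, hp, hpz⟩ := hext Y hY.connected (fun y => by
    obtain ⟨x, ⟨f⟩⟩ := hloc y
    obtain ⟨φ, hφ, -⟩ := f.exists_isBallIso
    obtain ⟨⟨x', hx', hy⟩, -⟩ := hφ.dist_center_le hX.connected hY.connected hB
    exact ⟨x', φ, hφ.restrict hX.connected hY.connected (by omega) (by rw [hy]; simp), hy⟩) x φ hφx
  refine ⟨p, hp, fun z hz => ?_⟩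
  rw [← hφf]
  refine hpz z.1 ?_
  have h1 : (X.dist x z.1 : ℝ) ≤ r := hz
  exact_mod_cast h1.trans hr'

end BallIsometries

/-! ### The tree of reduced words -/

section FreeGroups

open SimpleGraph

/-- A graph in which every vertex but the root has a parent, whose edges join the vertices to
their parents, is a tree. -/
theorem isTree_of_parent {W : Type*} {T : SimpleGraph W} (root : W) (parent : W → W)
    (height : W → ℕ)
    (hadj : ∀ a b, T.Adj a b ↔ (a ≠ root ∧ b = parent a) ∨ (b ≠ root ∧ a = parent b))
    (hheight : ∀ a, a ≠ root → height a = height (parent a) + 1) : T.IsTree := by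
  have hreach : ∀ a, T.Reachable a root := fun a => by
    induction hn : height a generalizing a with
    | zero =>
      by_cases ha : a = root
      · rw [ha]
      · have := hheight a ha
        omega
    | succ n ih =>
      by_cases ha : a = root
      · rw [ha]
      · have := hheight a ha
        exact ((hadj a (parent a)).2 (Or.inl ⟨ha, rfl⟩)).reachable.trans (ih _ (by omega))
  -- `Desc b a` means that `b` is `a` or a descendant of `a`. A walk that leaves the descendants of
  -- `a` must cross the edge from `a` to its parent, so that edge is a bridge.
  let Desc : W → W → Prop := Relation.ReflTransGen fun b c => b ≠ root ∧ c = parent b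
  have hDesc : ∀ b a, Desc b a → height a ≤ height b := fun b a h => by
    induction h with
    | refl => exact le_rfl
    | tail _ h ih =>
      obtain ⟨h1, rfl⟩ := h
      have := hheight _ h1
      omega
  have hwalk : ∀ a b c (p : T.Walk b c), Desc b a → ¬ Desc c a → s(a, parent a) ∈ p.edges := by
    intro a b c p hb hc
    induction p with
    | nil => exact absurd hb hc
    | @cons b b' c h p ih =>
      rw [Walk.edges_cons, List.mem_cons]
      by_cases hb' : Desc b' a
      · exact Or.inr (ih hb' hc)
      · left
        rcases (hadj b b').1 h with ⟨h1, rfl⟩ | ⟨h1, rfl⟩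
        · rcases Relation.ReflTransGen.cases_head hb with rfl | ⟨d, ⟨-, rfl⟩, hd⟩
          · rfl
          · exact absurd hd hb'
        · exact absurd (Relation.ReflTransGen.head ⟨h1, rfl⟩ hb) hb'
  have hbridge : ∀ a, a ≠ root → T.IsBridge s(a, parent a) := fun a ha => by
    refine isBridge_iff_forall_walk_mem_edges.2 fun p => hwalk a _ _ p .refl fun h => ?_
    have h1 := hDesc _ _ h
    have h2 := hheight a ha
    omega
  have : Nonempty W := ⟨root⟩
  refine ⟨⟨fun a b => (hreach a).trans (hreach b).symm⟩, isAcyclic_iff_forall_adj_isBridge.2 ?_⟩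
  intro a b hab
  rcases (hadj a b).1 hab with ⟨h1, rfl⟩ | ⟨h1, rfl⟩
  · exact hbridge a h1
  · rw [Sym2.eq_swap]
    exact hbridge b h1

open Classical in
/-- The tree of reduced words, in which the parent of a word is its tail. -/
def wordTree (α : Type u) : SimpleGraph (FreeGroup α) :=
  SimpleGraph.fromRel fun a b => a ≠ 1 ∧ b = FreeGroup.mk a.toWord.tail

open Classical in
theorem toWord_mk_tail {α : Type u} (a : FreeGroup α) :
    (FreeGroup.mk a.toWord.tail).toWord = a.toWord.tail := by
  rw [FreeGroup.toWord_mk]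
  exact (FreeGroup.isReduced_toWord.infix (List.tail_suffix _).isInfix).reduce_eq

open Classical in
theorem norm_mk_tail {α : Type u} {a : FreeGroup α} (ha : a ≠ 1) :
    a.norm = (FreeGroup.mk a.toWord.tail).norm + 1 := by
  have h : a.toWord ≠ [] := fun h => ha (FreeGroup.toWord_eq_nil_iff.1 h)
  rw [FreeGroup.norm, FreeGroup.norm, toWord_mk_tail, List.length_tail]
  have := List.length_pos_of_ne_nil h
  omega

open Classical in
theorem wordTree_adj {α : Type u} (a b : FreeGroup α) : (wordTree α).Adj a b ↔
    (a ≠ 1 ∧ b = FreeGroup.mk a.toWord.tail) ∨ (b ≠ 1 ∧ a = FreeGroup.mk b.toWord.tail) := by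
  rw [wordTree, SimpleGraph.fromRel_adj, and_iff_right_iff_imp]
  rintro (⟨h1, h2⟩ | ⟨h1, h2⟩) rfl <;>
  · have := norm_mk_tail h1
    rw [← h2] at this
    omega

theorem isTree_wordTree (α : Type u) : (wordTree α).IsTree := by
  classical
  exact isTree_of_parent 1 (fun a => FreeGroup.mk a.toWord.tail) FreeGroup.norm wordTree_adj
    fun a ha => norm_mk_tail ha

/-- If the new letter cancels the first letter of `a`, the product is the parent of `a`; otherwise
`a` is the parent of the product. -/
theorem wordTree_adj_mk_mul {α : Type u} (x : α × Bool) (a : FreeGroup α) :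
    (wordTree α).Adj a (FreeGroup.mk [x] * a) := by
  classical
  rw [wordTree_adj]
  have h1 : (FreeGroup.mk [x] * a).toWord = FreeGroup.reduce (x :: a.toWord) := by
    rw [← FreeGroup.toWord_mk, ← List.singleton_append (x := x) (l := a.toWord),
      ← FreeGroup.mul_mk, FreeGroup.mk_toWord]
  rw [FreeGroup.reduce.cons, FreeGroup.reduce_toWord] at h1
  have key : ∀ l, (FreeGroup.mk [x] * a).toWord = x :: l → a.toWord = l →
      FreeGroup.mk [x] * a ≠ 1 ∧ a = FreeGroup.mk (FreeGroup.mk [x] * a).toWord.tail := by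
    intro l h h'
    refine ⟨fun h2 => ?_, ?_⟩
    · rw [h2, FreeGroup.toWord_one] at h
      exact List.cons_ne_nil _ _ h.symm
    · rw [h, List.tail_cons, ← h', FreeGroup.mk_toWord]
  cases h2 : a.toWord with
  | nil =>
    rw [h2] at h1
    right
    exact key _ h1 h2
  | cons y l =>
    rw [h2] at h1
    by_cases hxy : x.1 = y.1 ∧ x.2 = !y.2
    · left
      refine ⟨fun h3 => ?_, ?_⟩
      · rw [h3, FreeGroup.toWord_one] at h2
        exact List.cons_ne_nil _ _ h2.symm
      · apply FreeGroup.toWord_injective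
        rw [List.tail_cons, ← List.tail_cons (a := y) (as := l), ← h2, toWord_mk_tail, h2, h1]
        simp [hxy]
    · right
      refine key (y :: l) ?_ h2
      rw [h1]
      simp only [hxy, if_false]

theorem exists_eq_mk_mul_of_wordTree_adj {α : Type u} {a b : FreeGroup α}
    (h : (wordTree α).Adj a b) : ∃ x, b = FreeGroup.mk [x] * a := by
  classical
  have key : ∀ {a b : FreeGroup α}, a ≠ 1 → b = FreeGroup.mk a.toWord.tail →
      ∃ x, a = FreeGroup.mk [x] * b := by
    rintro a _ ha rfl
    obtain ⟨x, l, hxl⟩ := List.exists_cons_of_ne_nil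
      (fun h => ha (FreeGroup.toWord_eq_nil_iff.1 h))
    refine ⟨x, ?_⟩
    rw [FreeGroup.mul_mk, hxl, List.tail_cons, List.singleton_append, ← hxl, FreeGroup.mk_toWord]
  rcases (wordTree_adj a b).1 h with ⟨h1, h2⟩ | ⟨h1, h2⟩
  · obtain ⟨x, hx⟩ := key h1 h2
    refine ⟨(x.1, !x.2), ?_⟩
    have h3 : FreeGroup.mk [(x.1, !x.2)] = (FreeGroup.mk [x])⁻¹ := by
      simp [FreeGroup.inv_mk, FreeGroup.invRev]
    rw [h3, eq_inv_mul_iff_mul_eq]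
    exact hx.symm
  · exact key h1 h2

open Classical in
theorem wordTree_dist_mul_le {α : Type u} (x a : FreeGroup α) :
    (wordTree α).dist a (x * a) ≤ x.norm := by
  have h : ∀ l : List (α × Bool), (wordTree α).dist a (FreeGroup.mk l * a) ≤ l.length := by
    intro l
    induction l with
    | nil => rw [← FreeGroup.one_eq_mk, one_mul]; simp
    | cons y l ih =>
      have h1 : FreeGroup.mk (y :: l) * a = FreeGroup.mk [y] * (FreeGroup.mk l * a) := by
        rw [← mul_assoc, FreeGroup.mul_mk, List.singleton_append]
      rw [h1]
      have h2 := dist_adj_le (isTree_wordTree α).connected a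
        (wordTree_adj_mk_mul y (FreeGroup.mk l * a))
      rw [List.length_cons]
      omega
  have := h x.toWord
  rwa [FreeGroup.mk_toWord] at this

/-- The abelianization is a finitely generated free abelian group with basis `α`. -/
theorem finite_of_freeGroup_fg (α : Type u) [Group.FG (FreeGroup α)] : Finite α := by
  have h1 : Group.FG (Abelianization (FreeGroup α)) :=
    Group.fg_of_surjective (f := Abelianization.of) (Quotient.mk_surjective)
  have h2 : AddGroup.FG (FreeAbelianGroup α) := GroupFG.iff_add_fg.1 h1
  have h3 : Module.Finite ℤ (FreeAbelianGroup α) := Module.Finite.iff_addGroup_fg.2 h2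
  exact Module.Finite.finite_basis (FreeAbelianGroup.basis α)

end FreeGroups

/-! ### Cayley graphs of virtually free groups -/

section CayleyGraphs

open SimpleGraph

variable {Γ : Type u} [Group Γ] {S : Set Γ}

/-- Left multiplication as an automorphism of a Cayley graph. -/
def mulLeftIso (S : Set Γ) (g : Γ) : mulCayley S ≃g mulCayley S where
  toEquiv := Equiv.mulLeft g
  map_rel_iff' := mulCayley_adj_mul_iff_right

theorem dist_mulCayley_mul_left (g a b : Γ) :
    (mulCayley S).dist (g * a) (g * b) = (mulCayley S).dist a b :=
  dist_iso_apply (mulLeftIso S g) a b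

theorem connected_mulCayley (hS : Subgroup.closure S = ⊤) : (mulCayley S).Connected := by
  have h : ∀ x ∈ Subgroup.closure S, ∀ g, (mulCayley S).Reachable g (g * x) := fun x hx => by
    induction hx using Subgroup.closure_induction with
    | mem s hs =>
      intro g
      by_cases hg : g = g * s
      · rw [← hg]
      · exact Adj.reachable ((mulCayley_adj _ _ _).2 ⟨hg, Or.inl (by simpa using hs)⟩)
    | one => intro g; rw [mul_one]
    | mul x y _ _ hx hy =>
      intro g
      rw [← mul_assoc]
      exact (hx g).trans (hy (g * x))
    | inv x _ hx =>
      intro g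
      have := (hx (g * x⁻¹)).symm
      rwa [inv_mul_cancel_right] at this
  refine ⟨fun a b => ?_⟩
  have := h (a⁻¹ * b) (by rw [hS]; trivial) a
  rwa [mul_inv_cancel_left] at this

theorem isLocallyFinite_mulCayley (hS : S.Finite) : IsLocallyFinite (mulCayley S) := fun g => by
  refine ((hS.union hS.inv).image (g * ·)).subset fun h hh => ?_
  refine ⟨g⁻¹ * h, ?_, by simp⟩
  rcases ((mulCayley_adj _ _ _).1 hh).2 with h1 | h1
  · exact Or.inl h1
  · exact Or.inr (by simpa using h1)

theorem hasCocompactIsometryGroup_mulCayley (S : Set Γ) :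
    HasCocompactIsometryGroup (mulCayley S) :=
  ⟨{1}, fun x => ⟨1, by simp, mulLeftIso S x, mul_one x⟩⟩

/-- A Cayley graph of a group with a free subgroup of finite index is coarsely equivalent to the
tree of reduced words in a basis of the subgroup. -/
theorem exists_isCoarse_wordTree {α : Type u} (hfin : S.Finite) (hS : Subgroup.closure S = ⊤)
    (H : Subgroup Γ) [H.FiniteIndex] (e : H ≃* FreeGroup α) :
    ∃ c q, IsCoarse (mulCayley S) (wordTree α) c q := by
  classical
  have hX := connected_mulCayley hS
  have hT := isTree_wordTree α
  have : Group.FG Γ := ⟨⟨hfin.toFinset, by simpa using hS⟩⟩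
  have : Group.FG H := H.fg_of_index_ne_zero
  have : Group.FG (FreeGroup α) := Group.fg_of_surjective (f := e.toMonoidHom) e.surjective
  have : Finite α := finite_of_freeGroup_fg α
  -- Right multiplication by `o g`, one of finitely many coset representatives, moves `g` into `H`
  -- by a bounded distance.
  let o : Γ → Γ := fun g => (QuotientGroup.mk g⁻¹ : Γ ⧸ H).out
  have ho : ∀ g, g * o g ∈ H := fun g => by
    obtain ⟨h, hh⟩ := QuotientGroup.mk_out_eq_mul H g⁻¹
    change g * (QuotientGroup.mk g⁻¹ : Γ ⧸ H).out ∈ H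
    rw [hh, mul_inv_cancel_left]
    exact h.2
  let O : Set Γ := Set.range (Quotient.out : Γ ⧸ H → Γ)
  have hO : O.Finite := by
    have : Finite (Quotient (QuotientGroup.leftRel H)) :=
      inferInstanceAs (Finite (Γ ⧸ H))
    exact Set.finite_range _
  have hoO : ∀ g, o g ∈ O := fun g => ⟨_, rfl⟩
  -- The inverse reconciles the two sides: edges of the Cayley graph are right multiplications,
  -- those of the word tree left multiplications. Accordingly `ι` is an antihomomorphism.
  let q : Γ → FreeGroup α := fun g => (e ⟨g * o g, ho g⟩)⁻¹
  let ι : FreeGroup α → Γ := fun t => ((e.symm t)⁻¹ : H)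
  have hι : ∀ g, ι (q g) = g * o g := fun g => by simp [ι, q]
  have hmul : ∀ x t, ι (x * t) = ι t * ι x := fun x t => by simp [ι]
  have hinj : Function.Injective ι := fun a b h => by simpa [ι] using h
  have hnorm : ∀ A : Set Γ, A.Finite → ∃ k, ∀ x, ι x ∈ A → x.norm ≤ k := fun A hA => by
    obtain ⟨k, hk⟩ := ((hA.preimage hinj.injOn).image FreeGroup.norm).bddAbove
    exact ⟨k, fun x hx => hk ⟨x, hx, rfl⟩⟩
  -- `k₁` is a Lipschitz constant for `q` and `k₃` one for `ι`; `k₂` bounds the distance from `t` to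
  -- `q (ι t)`, and `k₄` that from `g` to `ι (q g)`.
  obtain ⟨k₁, hk₁⟩ := hnorm _ ((hO.inv.mul (hfin.union hfin.inv)).mul hO)
  obtain ⟨k₂, hk₂⟩ := hnorm O hO
  obtain ⟨k₃, hk₃⟩ := (Set.finite_range fun x : α × Bool =>
    (mulCayley S).dist 1 (ι (FreeGroup.mk [x]))).bddAbove
  obtain ⟨k₄, hk₄⟩ := (hO.image fun x => (mulCayley S).dist 1 x).bddAbove
  have hq : ∀ a b, (wordTree α).dist (q a) (q b) ≤ k₁ * (mulCayley S).dist a b := by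
    refine dist_le_mul_of_adj hX hT.connected fun a b hab => ?_
    have h1 := wordTree_dist_mul_le (q b * (q a)⁻¹) (q a)
    rw [inv_mul_cancel_right] at h1
    refine h1.trans (hk₁ _ ?_)
    have h2 : ι (q b * (q a)⁻¹) = (o a)⁻¹ * (a⁻¹ * b) * o b := by
      have h3 := hmul (q b * (q a)⁻¹) (q a)
      rw [inv_mul_cancel_right, hι, hι] at h3
      rw [eq_comm, ← inv_mul_eq_iff_eq_mul] at h3
      rw [← h3]
      group
    rw [h2]
    refine Set.mul_mem_mul (Set.mul_mem_mul (Set.inv_mem_inv.2 (hoO a)) ?_) (hoO b)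
    rcases ((mulCayley_adj _ _ _).1 hab).2 with h | h
    · exact Or.inl h
    · exact Or.inr (by simpa using h)
  have hιdist : ∀ a b, (mulCayley S).dist (ι a) (ι b) ≤ k₃ * (wordTree α).dist a b := by
    refine dist_le_mul_of_adj hT.connected hX fun a b hab => ?_
    obtain ⟨x, rfl⟩ := exists_eq_mk_mul_of_wordTree_adj hab
    have h1 := dist_mulCayley_mul_left (S := S) (ι a) 1 (ι (FreeGroup.mk [x]))
    rw [mul_one, ← hmul] at h1
    rw [h1]
    exact hk₃ ⟨x, rfl⟩
  have ho₄ : ∀ g, (mulCayley S).dist g (ι (q g)) ≤ k₄ := fun g => by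
    have h1 := dist_mulCayley_mul_left (S := S) g 1 (o g)
    rw [mul_one] at h1
    rw [hι, h1]
    exact hk₄ ⟨o g, hoO g, rfl⟩
  refine ⟨k₁ + k₂ + k₃ + 2 * k₄ + 1, q, fun t => ⟨ι t, ?_⟩, fun a b => ?_, fun a b => ?_⟩
  · have h1 := wordTree_dist_mul_le (q (ι t) * t⁻¹) t
    rw [inv_mul_cancel_right] at h1
    have h2 : ι (q (ι t) * t⁻¹) = o (ι t) := by
      have h3 := hmul (q (ι t) * t⁻¹) t
      rw [inv_mul_cancel_right, hι] at h3
      exact (mul_left_cancel h3).symm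
    have h3 := hk₂ _ (h2 ▸ hoO (ι t))
    omega
  · have h1 := ho₄ a
    have h2 := ho₄ b
    have h3 := hιdist (q a) (q b)
    have h4 : (mulCayley S).dist a b ≤ (mulCayley S).dist a (ι (q a)) +
      (mulCayley S).dist (ι (q a)) b := hX.dist_triangle
    have h5 : (mulCayley S).dist (ι (q a)) b ≤ (mulCayley S).dist (ι (q a)) (ι (q b)) +
      (mulCayley S).dist (ι (q b)) b := hX.dist_triangle
    rw [SimpleGraph.dist_comm] at h2
    generalize (wordTree α).dist (q a) (q b) = d at *
    nlinarith
  · refine (hq a b).trans ((Nat.mul_le_mul_right _ ?_).trans (Nat.le_add_right _ _))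
    omega

theorem isSLGRigid_mulCayley (hΓ : IsVirtuallyFree Γ) (hfin : S.Finite)
    (hS : Subgroup.closure S = ⊤) : IsSLGRigid.{u, v} (mulCayley S) := by
  obtain ⟨H, _, hH⟩ := hΓ
  obtain ⟨α, ⟨b⟩⟩ := hH.nonempty_basis
  obtain ⟨c, q, hq⟩ := exists_isCoarse_wordTree hfin hS H b.repr
  exact isSLGRigid_of_isCoarse ⟨connected_mulCayley hS, isLocallyFinite_mulCayley hfin⟩
    (hasCocompactIsometryGroup_mulCayley S) (isTree_wordTree α) hq

end CayleyGraphs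

end LocalGlobal

theorem mainTheorem2 :
    (∀ (V : Type u) (X : SimpleGraph V),
      LocalGlobal.IsQuasiTree.{u, w} X → LocalGlobal.HasCocompactIsometryGroup X →
        LocalGlobal.IsSLGRigid.{u, v} X) ∧
    (∀ (Γ : Type u) [Group Γ] (S : Set Γ),
      LocalGlobal.IsVirtuallyFree Γ → S.Finite → (∀ s ∈ S, s⁻¹ ∈ S) → Subgroup.closure S = ⊤ →
        LocalGlobal.IsSLGRigid.{u, v} (SimpleGraph.mulCayley S)) := by
  refine ⟨fun V X hX hc => ?_, fun Γ _ S hΓ hfin _ hS =>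
    LocalGlobal.isSLGRigid_mulCayley hΓ hfin hS⟩
  obtain ⟨hX, W, T, hT, C, K, f, hf⟩ := hX
  obtain ⟨c, hq⟩ := hf.exists_isCoarse
  exact LocalGlobal.isSLGRigid_of_isCoarse hX hc hT hq
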